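/- **Setting.** Let $\mathcal L$ be the square lattice $\mathbb Z^2$, with vertex set $V$, set of unoriented edges $E$ and set of faces $\tilde V$. For a finite $\Lambda\subset E$ put $\mathcal H_\Lambda=\bigotimes_{e\in\Lambda}\mathbb C^2$ and $\mathcal A_\Lambda=\mathbb B(\mathcal H_\Lambda)$, and identify $a\in\mathcal A_{\Lambda'}$ with $a\otimes \mathbf 1_{\Lambda\setminus\Lambda'}\in\mathcal A_\Lambda$ when $\Lambda'\subset\Lambda$. Let $\mathcal A_{\rm loc}=\bigcup_\Lambda\mathcal A_\Lambda$, with its $C^*$-norm. For $v\in V$ let $A_v=\prod_{e\ni v}\sigma^x_e$, for $\tilde v\in\tilde V$ let $B_{\tilde v}=\prod_{e\in\partial\tilde v}\sigma^z_e$, and let $W=V\sqcup\tilde V$, $S_w=A_w$ for $w\in V$ and $S_w=B_w$ for $w\in\tilde V$. For $f\in\Omega=\{-1,1\}^W$ and finite $\Lambda\subset E$ define $$Q_w(f)=\tfrac12\big(\mathbf 1+f(w)S_w\big),\qquad P_\Lambda(f)=\prod_{w\in W:\,Q_w(f)\in\mathcal A_\Lambda}Q_w(f),$$ and, for $X\in\mathcal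 A_\Lambda$, $$\omega_\Lambda^f(X)=\frac{\mathrm{Tr}\big(P_\Lambda(f)XP_\Lambda(f)\big)}{\mathrm{Tr}\big(P_\Lambda(f)\big)},$$ where $\mathrm{Tr}$ is the trace over $\mathcal H_\Lambda$. **Theorem 3.6 (LTQO for all $f$).** For every $f\in\Omega$: 1. $\{P_\Lambda(f)\}_\Lambda$ is a frustration-free net of proper projections: each $P_\Lambda(f)$ is a non-zero orthogonal projection in $\mathcal A_\Lambda$, and $P_\Lambda(f)\le P_{\Lambda'}(f)$ whenever $\Lambda'\subset\Lambda$. 2. The net satisfies local topological quantum order: for every $X\in\mathcal A_{\rm loc}$, $$\lim_{\Lambda}\big\|P_\Lambda(f)XP_\Lambda(f)-\omega^f_\Lambda(X)P_\Lambda(f)\big\|=0,$$ the limit being along the finite subsets of $E$ directed by inclusion. 3. More precisely, for every finite $\Lambda\subset E$ there is a finite $\Delta\supset\Lambda$ such that $P_\Delta(f)XP_\Delta(f)=\omega^f_\Delta(X)P_\Delta(f)$ for all $X\in\mathcal A_\Lambda$. -/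

import Mathlib

open Filter Topology

namespace ToricCode

/-! ### The square lattice -/

/-- Vertices of the square lattice `ℤ²`. -/
abbrev Vertex : Type := ℤ × ℤ

/-- Faces of the square lattice, i.e. vertices of the dual lattice; the face `(x, y)` is the unit
square whose lower left corner is the vertex `(x, y)`. -/
abbrev Face : Type := ℤ × ℤ

/-- Unoriented edges of the square lattice: `(x, y, false)` is the horizontal edge joining `(x, y)`
to `(x + 1, y)`, and `(x, y, true)` is the vertical edge joining `(x, y)` to `(x, y + 1)`. -/
abbrev Edge : Type := ℤ × ℤ × Bool

/-- The two end points of an edge. -/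
def endpoints : Edge → Finset Vertex
  | (x, y, false) => {(x, y), (x + 1, y)}
  | (x, y, true) => {(x, y), (x, y + 1)}

/-- The star of a vertex: the four edges that end at it. -/
def vertexStar : Vertex → Finset Edge
  | (x, y) => {(x, y, false), (x - 1, y, false), (x, y, true), (x, y - 1, true)}

/-- The boundary of a face: its lower, upper, left and right edge. -/
def faceBoundary : Face → Finset Edge
  | (x, y) => {(x, y, false), (x, y + 1, false), (x, y, true), (x + 1, y, true)}

theorem mem_vertexStar_iff (e : Edge) (v : Vertex) : e ∈ vertexStar v ↔ v ∈ endpoints e := by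
  obtain ⟨x, y, b⟩ := e
  obtain ⟨x', y'⟩ := v
  cases b <;> simp [vertexStar, endpoints] <;> omega

/-! ### Local observables

The spin configurations with finitely many edges in the state `|1⟩` (and all others in `|0⟩`) are
encoded by the finite set of edges in the state `|1⟩`.  They label an orthonormal basis of
`⨂_{e ∈ E} (ℂ², |0⟩)`.  Likewise the subsets of a finite set `Λ` of edges label the product basis
of `H_Λ = ⨂_{e ∈ Λ} ℂ²`, so that `𝔹(H_Λ)` is the algebra of matrices indexed by `Λ.powerset`. -/

/-- The Hilbert space `⨂_{e ∈ E} (ℂ², |0⟩)` on which all observables act. -/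
abbrev Hilb : Type := lp (fun _ : Finset Edge => ℂ) 2

/-- Bounded operators on `Hilb`. -/
abbrev Op : Type := Hilb →L[ℂ] Hilb

/-- `𝔹(H_Λ)`, as matrices in the product basis of `H_Λ = ⨂_{e ∈ Λ} ℂ²`. -/
abbrev LocalMatrix (Λ : Finset Edge) : Type := Matrix Λ.powerset Λ.powerset ℂ

/-- The part of a configuration inside `Λ`. -/
def inside (Λ : Finset Edge) (c : Finset Edge) : Λ.powerset :=
  ⟨c ∩ Λ, by simp⟩

/-- The configuration that agrees with `s` inside `Λ` and with `c` outside `Λ`. -/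
def glue (Λ : Finset Edge) (c : Finset Edge) (s : Λ.powerset) : Finset Edge :=
  (c \ Λ) ∪ s

theorem inside_glue (Λ c : Finset Edge) (s : Λ.powerset) : inside Λ (glue Λ c s) = s := by
  obtain ⟨s, hs⟩ := s
  rw [Finset.mem_powerset] at hs
  apply Subtype.ext
  ext e
  have := @hs e
  simp only [inside, glue, Finset.mem_inter, Finset.mem_union, Finset.mem_sdiff]
  tauto

theorem glue_glue (Λ c : Finset Edge) (s t : Λ.powerset) :
    glue Λ (glue Λ c s) t = glue Λ c t := by
  obtain ⟨s, hs⟩ := s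
  obtain ⟨t, ht⟩ := t
  rw [Finset.mem_powerset] at hs ht
  ext e
  have := @hs e
  simp only [glue, Finset.mem_union, Finset.mem_sdiff]
  tauto

theorem glue_inside (Λ c : Finset Edge) : glue Λ c (inside Λ c) = c := by
  ext e
  simp only [glue, inside, Finset.mem_union, Finset.mem_sdiff, Finset.mem_inter]
  tauto

theorem summable_glue (Λ : Finset Edge) (s : Λ.powerset) (g : Finset Edge → ℝ)
    (hg : ∀ c, 0 ≤ g c) (hs : Summable g) :
    Summable (fun c => g (glue Λ c s)) ∧
      ∑' c, g (glue Λ c s) ≤ (Λ.powerset.card : ℝ) * ∑' c, g c := by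
  have hH : HasSum (fun p : Λ.powerset × Finset Edge => g p.2)
      ((Λ.powerset.card : ℝ) * ∑' c, g c) := by
    have hs' : Summable (fun p : Λ.powerset × Finset Edge => g p.2) := by
      rw [summable_prod_of_nonneg (fun p => hg p.2)]
      exact ⟨fun _ => hs, Summable.of_finite⟩
    have h := hs'.hasSum
    rw [hs'.tsum_prod' (fun _ => hs), tsum_fintype] at h
    simp only at h
    rw [Finset.sum_const, nsmul_eq_mul, Finset.card_univ, Fintype.card_coe] at h
    exact h
  have hinj : Function.Injective (fun c => (inside Λ c, glue Λ c s)) := by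
    intro c d h
    simp only [Prod.mk.injEq] at h
    rw [← glue_inside Λ c, ← glue_inside Λ d, ← glue_glue Λ c s, h.1, h.2, glue_glue]
  refine ⟨hH.summable.comp_injective hinj, ?_⟩
  rw [← hH.tsum_eq]
  exact tsum_comp_le_tsum_of_inj hH.summable (fun p => hg p.2) hinj

theorem hilb_summable (ψ : Hilb) : Summable (fun c => ‖ψ c‖ ^ 2) := by
  simpa using (lp.memℓp ψ).summable (by norm_num : 0 < (2 : ENNReal).toReal)

theorem hilb_norm_sq (ψ : Hilb) : ‖ψ‖ ^ 2 = ∑' c, ‖ψ c‖ ^ 2 := by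
  simpa using lp.norm_rpow_eq_tsum (by norm_num : 0 < (2 : ENNReal).toReal) ψ

/-- For a matrix `a` on `H_Λ` and `s ⊆ Λ`, the operator
`ψ ↦ (c ↦ a (c ∩ Λ) s * ψ (s inside Λ, c outside Λ))`. -/
noncomputable def column (Λ : Finset Edge) (a : LocalMatrix Λ) (s : Λ.powerset) : Op :=
  have key : ∀ ψ : Hilb, Summable (fun c => ‖a (inside Λ c) s * ψ (glue Λ c s)‖ ^ 2) ∧
      ∑' c, ‖a (inside Λ c) s * ψ (glue Λ c s)‖ ^ 2 ≤
        (∑ r, ‖a r s‖) ^ 2 * ((Λ.powerset.card : ℝ) * ‖ψ‖ ^ 2) := by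
    intro ψ
    obtain ⟨h1, h3⟩ := summable_glue Λ s (fun c => ‖ψ c‖ ^ 2) (fun _ => by positivity)
      (hilb_summable ψ)
    rw [← hilb_norm_sq] at h3
    have hle : ∀ c, ‖a (inside Λ c) s * ψ (glue Λ c s)‖ ^ 2 ≤
        (∑ r, ‖a r s‖) ^ 2 * ‖ψ (glue Λ c s)‖ ^ 2 := by
      intro c
      rw [norm_mul, mul_pow]
      gcongr
      exact Finset.single_le_sum (f := fun r => ‖a r s‖) (fun _ _ => norm_nonneg _)
        (Finset.mem_univ _)
    have hs := Summable.of_nonneg_of_le (fun _ => by positivity) hle (h1.mul_left _)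
    refine ⟨hs, (hs.tsum_le_tsum hle (h1.mul_left _)).trans ?_⟩
    rw [tsum_mul_left]
    gcongr
  LinearMap.mkContinuous
    { toFun := fun ψ => ⟨fun c => a (inside Λ c) s * ψ (glue Λ c s),
        memℓp_gen (by simpa using (key ψ).1)⟩
      map_add' := by
        intro ψ φ
        ext c
        exact mul_add _ _ _
      map_smul' := by
        intro z ψ
        ext c
        exact mul_left_comm _ _ _ }
    ((∑ r, ‖a r s‖) * Real.sqrt (Λ.powerset.card : ℝ))
    (by
      intro ψ
      refine (sq_le_sq₀ (norm_nonneg _) (by positivity)).1 ?_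
      have h := hilb_norm_sq ⟨fun c => a (inside Λ c) s * ψ (glue Λ c s),
        memℓp_gen (by simpa using (key ψ).1)⟩
      have h' := (key ψ).2
      rw [mul_pow, mul_pow, Real.sq_sqrt (by positivity), mul_assoc]
      refine le_trans (le_of_eq ?_) h'
      exact h)

/-- The operator `a ⊗ 1` on `Hilb`, for a matrix `a` on `H_Λ`. -/
noncomputable def amplifyOp (Λ : Finset Edge) (a : LocalMatrix Λ) : Op :=
  ∑ s, column Λ a s

theorem amplifyOp_apply (Λ : Finset Edge) (a : LocalMatrix Λ) (ψ : Hilb) (c : Finset Edge) :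
    amplifyOp Λ a ψ c = ∑ s, a (inside Λ c) s * ψ (glue Λ c s) := by
  simp only [amplifyOp, sum_apply]
  rw [lp.coeFn_sum, Finset.sum_apply]
  rfl

theorem op_ext {S T : Op} (h : ∀ ψ c, S ψ c = T ψ c) : S = T := by
  apply ContinuousLinearMap.ext
  intro ψ
  apply lp.ext
  funext c
  exact h ψ c

/-- The basis vector of `Hilb` labelled by the configuration `c`. -/
noncomputable def basisVec (c : Finset Edge) : Hilb := lp.single 2 c 1

theorem basisVec_apply (c d : Finset Edge) : basisVec c d = if d = c then 1 else 0 := by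
  by_cases h : d = c
  · subst h; simp [basisVec]
  · simp [basisVec, h]

theorem inner_basisVec (c : Finset Edge) (ψ : Hilb) : inner ℂ (basisVec c) ψ = ψ c := by
  simp [basisVec, lp.inner_single_left]

theorem glue_eq_iff (Λ c d : Finset Edge) (s : Λ.powerset) :
    glue Λ d s = c ↔ s = inside Λ c ∧ d = glue Λ c (inside Λ d) := by
  constructor
  · rintro rfl
    rw [inside_glue, glue_glue, glue_inside]
    exact ⟨rfl, rfl⟩
  · rintro ⟨rfl, h⟩
    rw [h, glue_glue, glue_inside]

theorem amplifyOp_conjTranspose (Λ : Finset Edge) (a : LocalMatrix Λ) :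
    amplifyOp Λ a.conjTranspose = ContinuousLinearMap.adjoint (amplifyOp Λ a) := by
  apply op_ext
  intro ψ c
  rw [← inner_basisVec c (ContinuousLinearMap.adjoint _ ψ),
    ContinuousLinearMap.adjoint_inner_right, amplifyOp_apply]
  have h : amplifyOp Λ a (basisVec c) = ∑ s, a s (inside Λ c) • basisVec (glue Λ c s) := by
    apply lp.ext
    funext d
    rw [amplifyOp_apply, lp.coeFn_sum, Finset.sum_apply]
    simp only [lp.coeFn_smul, Pi.smul_apply, smul_eq_mul, basisVec_apply]
    rw [Finset.sum_eq_single (inside Λ c), Finset.sum_eq_single (inside Λ d)]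
    · have : glue Λ d (inside Λ c) = c ↔ d = glue Λ c (inside Λ d) := by
        rw [glue_eq_iff]; simp
      simp only [this]
    · intro s _ hs
      rw [if_neg, mul_zero]
      intro h
      exact hs ((glue_eq_iff _ _ _ _).1 h.symm).1
    · simp
    · intro s _ hs
      rw [if_neg, mul_zero]
      intro h
      exact hs ((glue_eq_iff _ _ _ _).1 h).1
    · simp
  rw [h, sum_inner]
  apply Finset.sum_congr rfl
  intro s _
  rw [inner_smul_left, inner_basisVec]
  rfl

/-- The inclusion `𝔹(H_Λ) → 𝔹(Hilb)`, `a ↦ a ⊗ 1`, as a homomorphism of star algebras. -/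
noncomputable def amplify (Λ : Finset Edge) : LocalMatrix Λ →⋆ₐ[ℂ] Op where
  toFun := amplifyOp Λ
  map_one' := by
    apply op_ext
    intro ψ c
    rw [amplifyOp_apply, Finset.sum_eq_single (inside Λ c)]
    · rw [Matrix.one_apply_eq, one_mul, glue_inside]; rfl
    · intro s _ hs
      rw [Matrix.one_apply_ne (Ne.symm hs), zero_mul]
    · simp
  map_mul' a b := by
    apply op_ext
    intro ψ c
    change _ = amplifyOp Λ a (amplifyOp Λ b ψ) c
    simp only [amplifyOp_apply, inside_glue, glue_glue, Matrix.mul_apply, Finset.mul_sum,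
      Finset.sum_mul, mul_assoc]
    exact Finset.sum_comm
  map_zero' := by
    apply op_ext
    intro ψ c
    rw [amplifyOp_apply]
    simp
  map_add' a b := by
    apply op_ext
    intro ψ c
    change _ = amplifyOp Λ a ψ c + amplifyOp Λ b ψ c
    simp only [amplifyOp_apply, Matrix.add_apply, add_mul, Finset.sum_add_distrib]
  commutes' z := by
    apply op_ext
    intro ψ c
    rw [amplifyOp_apply, Finset.sum_eq_single (inside Λ c)]
    · rw [Matrix.algebraMap_matrix_apply, if_pos rfl, glue_inside]
      rfl
    · intro s _ hs
      rw [Matrix.algebraMap_matrix_apply, if_neg (Ne.symm hs), zero_mul]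
    · simp
  map_star' a := amplifyOp_conjTranspose Λ a

theorem amplify_apply (Λ : Finset Edge) (a : LocalMatrix Λ) (ψ : Hilb) (c : Finset Edge) :
    amplify Λ a ψ c = ∑ s, a (inside Λ c) s * ψ (glue Λ c s) :=
  amplifyOp_apply Λ a ψ c

/-- The algebra `𝒜_Λ = 𝔹(H_Λ) ⊗ 1` of observables supported in `Λ`. -/
noncomputable def localAlg (Λ : Finset Edge) : StarSubalgebra ℂ Op := (amplify Λ).range

/-- The algebra of local observables `𝒜_loc`, the union of all the `𝒜_Λ`.  Its norm closure is
the quasi-local algebra, whose norm is the operator norm. -/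
def localObservables : Set Op := ⋃ Λ : Finset Edge, (localAlg Λ : Set Op)

/-- The trace over `H_Λ` of an element of `𝒜_Λ`: the sum of the diagonal matrix elements
`⟨s, T s⟩` over the product basis of `H_Λ`. -/
noncomputable def localTrace (Λ : Finset Edge) (T : Op) : ℂ :=
  ∑ s ∈ Λ.powerset, inner ℂ (basisVec s) (T (basisVec s))

theorem localTrace_amplify (Λ : Finset Edge) (a : LocalMatrix Λ) :
    localTrace Λ (amplify Λ a) = a.trace := by
  rw [localTrace, Matrix.trace, ← Finset.sum_coe_sort]
  apply Finset.sum_congr rfl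
  intro s _
  have hs : inside Λ s = s := by
    apply Subtype.ext
    exact Finset.inter_eq_left.2 (Finset.mem_powerset.1 s.2)
  rw [inner_basisVec, amplify_apply, Finset.sum_eq_single s]
  · have h : glue Λ (s : Finset Edge) s = s := by
      rw [glue_eq_iff, hs]
      exact ⟨rfl, by conv_lhs => rw [← glue_inside Λ s, hs]⟩
    rw [hs, basisVec_apply, if_pos h, mul_one, Matrix.diag_apply]
  · intro t _ ht
    rw [basisVec_apply, if_neg, mul_zero]
    intro h
    exact ht (((glue_eq_iff _ _ _ _).1 h).1.trans hs)
  · simp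

/-! ### Star and face operators -/

/-- The state, `0` or `1`, of the edge `e` in the configuration `s`. -/
def spin (e : Edge) (s : Finset Edge) : Fin 2 := if e ∈ s then 1 else 0

/-- The `2 × 2` matrix `M` acting on the edge `e`. -/
noncomputable def siteOp (e : Edge) (M : Matrix (Fin 2) (Fin 2) ℂ) : Op :=
  amplify {e} (Matrix.of fun s t => M (spin e s) (spin e t))

/-- The Pauli matrix `σ^x` on the edge `e`. -/
noncomputable def sigmaX (e : Edge) : Op := siteOp e !![0, 1; 1, 0]

/-- The Pauli matrix `σ^z` on the edge `e`. -/
noncomputable def sigmaZ (e : Edge) : Op := siteOp e !![1, 0; 0, -1]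

theorem siteOp_apply (e : Edge) (M : Matrix (Fin 2) (Fin 2) ℂ) (ψ : Hilb) (c : Finset Edge) :
    siteOp e M ψ c = M (spin e c) 0 * ψ (c \ {e}) + M (spin e c) 1 * ψ (c \ {e} ∪ {e}) := by
  rw [siteOp, amplify_apply]
  have h := Finset.sum_coe_sort ({e} : Finset Edge).powerset
    (fun s => M (spin e (c ∩ {e})) (spin e s) * ψ (c \ {e} ∪ s))
  refine Eq.trans h ?_
  have h' : ({e} : Finset Edge).powerset = {∅, {e}} := by
    ext x
    simp [Finset.subset_singleton_iff]
  rw [h', Finset.sum_pair (by simp)]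
  simp [spin]

theorem sigmaX_apply (e : Edge) (ψ : Hilb) (c : Finset Edge) :
    sigmaX e ψ c = ψ (symmDiff c {e}) := by
  rw [sigmaX, siteOp_apply]
  by_cases h : e ∈ c
  · have : symmDiff c {e} = c \ {e} := by
      ext x; simp only [Finset.mem_symmDiff, Finset.mem_sdiff, Finset.mem_singleton]; grind
    simp [spin, h, this]
  · have : symmDiff c {e} = c \ {e} ∪ {e} := by
      ext x
      simp only [Finset.mem_symmDiff, Finset.mem_sdiff, Finset.mem_singleton, Finset.mem_union]
      grind
    rw [this]
    simp [spin, h]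

theorem sigmaZ_apply (e : Edge) (ψ : Hilb) (c : Finset Edge) :
    sigmaZ e ψ c = (if e ∈ c then -1 else 1) * ψ c := by
  rw [sigmaZ, siteOp_apply]
  by_cases h : e ∈ c
  · have : c \ {e} ∪ {e} = c := by
      ext x; simp only [Finset.mem_sdiff, Finset.mem_singleton, Finset.mem_union]; grind
    rw [this]
    simp [spin, h]
  · have : c \ {e} = c := by
      ext x; simp only [Finset.mem_sdiff, Finset.mem_singleton]; grind
    rw [this]
    simp [spin, h]

theorem sigmaX_comm (e e' : Edge) : Commute (sigmaX e) (sigmaX e') := by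
  apply op_ext
  intro ψ c
  change sigmaX e (sigmaX e' ψ) c = sigmaX e' (sigmaX e ψ) c
  simp only [sigmaX_apply]
  rw [symmDiff_right_comm]

theorem sigmaZ_comm (e e' : Edge) : Commute (sigmaZ e) (sigmaZ e') := by
  apply op_ext
  intro ψ c
  change sigmaZ e (sigmaZ e' ψ) c = sigmaZ e' (sigmaZ e ψ) c
  simp only [sigmaZ_apply]
  ring

/-- The star operator `A_v = ∏_{e ∋ v} σ^x_e`. -/
noncomputable def starOp (v : Vertex) : Op :=
  (vertexStar v).noncommProd sigmaX (fun _ _ _ _ _ => sigmaX_comm _ _)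

/-- The face operator `B_p = ∏_{e ∈ p} σ^z_e`. -/
noncomputable def faceOp (p : Face) : Op :=
  (faceBoundary p).noncommProd sigmaZ (fun _ _ _ _ _ => sigmaZ_comm _ _)

theorem prod_sigmaX_apply (a : Finset Edge) (ψ : Hilb) (c : Finset Edge) :
    a.noncommProd sigmaX (fun _ _ _ _ _ => sigmaX_comm _ _) ψ c = ψ (symmDiff c a) := by
  induction a using Finset.induction_on generalizing c with
  | empty =>
    refine (congrArg (fun T : Op => T ψ c) (Finset.noncommProd_empty sigmaX _)).trans ?_
    exact congrArg ψ (symmDiff_bot c).symm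
  | insert e a he ih =>
    refine (congrArg (fun T : Op => T ψ c)
      (Finset.noncommProd_insert_of_notMem a e sigmaX _ he)).trans ?_
    change sigmaX e (Finset.noncommProd a sigmaX _ ψ) c = _
    have h : symmDiff (symmDiff c {e}) a = symmDiff c (insert e a) := by
      ext x
      simp only [Finset.mem_symmDiff, Finset.mem_insert, Finset.mem_singleton]
      grind
    rw [sigmaX_apply, ih, h]

theorem prod_sigmaZ_apply (a : Finset Edge) (ψ : Hilb) (c : Finset Edge) :
    a.noncommProd sigmaZ (fun _ _ _ _ _ => sigmaZ_comm _ _) ψ c =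
      (∏ e ∈ a, if e ∈ c then -1 else 1) * ψ c := by
  induction a using Finset.induction_on with
  | empty =>
    refine (congrArg (fun T : Op => T ψ c) (Finset.noncommProd_empty sigmaZ _)).trans ?_
    rw [Finset.prod_empty, one_mul]
    rfl
  | insert e a he ih =>
    refine (congrArg (fun T : Op => T ψ c)
      (Finset.noncommProd_insert_of_notMem a e sigmaZ _ he)).trans ?_
    rw [Finset.prod_insert he]
    change sigmaZ e (Finset.noncommProd a sigmaZ _ ψ) c = _
    rw [sigmaZ_apply, ih, mul_assoc]

theorem starOp_apply (v : Vertex) (ψ : Hilb) (c : Finset Edge) :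
    starOp v ψ c = ψ (symmDiff c (vertexStar v)) := prod_sigmaX_apply _ ψ c

theorem faceOp_apply (p : Face) (ψ : Hilb) (c : Finset Edge) :
    faceOp p ψ c = (∏ e ∈ faceBoundary p, if e ∈ c then -1 else 1) * ψ c :=
  prod_sigmaZ_apply _ ψ c

theorem prod_overlap (v : Vertex) (p : Face) :
    (∏ e ∈ faceBoundary p, if e ∈ vertexStar v then (-1 : ℂ) else 1) = 1 := by
  obtain ⟨x, y⟩ := v
  obtain ⟨x', y'⟩ := p
  rw [faceBoundary, Finset.prod_insert (by simp), Finset.prod_insert (by simp),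
    Finset.prod_insert (by simp), Finset.prod_singleton]
  by_cases h1 : x = x' <;> by_cases h2 : x = x' + 1 <;> by_cases h3 : y = y' <;>
    by_cases h4 : y = y' + 1 <;> simp [vertexStar] <;> grind

theorem starOp_faceOp_comm (v : Vertex) (p : Face) : Commute (starOp v) (faceOp p) := by
  apply op_ext
  intro ψ c
  change starOp v (faceOp p ψ) c = faceOp p (starOp v ψ) c
  simp only [starOp_apply, faceOp_apply]
  congr 1
  have h := prod_overlap v p
  rw [← mul_one (∏ e ∈ faceBoundary p, if e ∈ c then (-1 : ℂ) else 1), ← h,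
    ← Finset.prod_mul_distrib]
  apply Finset.prod_congr rfl
  intro e _
  simp only [Finset.mem_symmDiff]
  by_cases h1 : e ∈ c <;> by_cases h2 : e ∈ vertexStar v <;> simp [h1, h2]

/-- The set `W = V ∪ Ṽ` of all vertices and faces (a disjoint union). -/
abbrev Site : Type := Vertex ⊕ Face

/-- The operator `S_w`: a star operator if `w` is a vertex, a face operator if `w` is a face. -/
noncomputable def stabilizer : Site → Op
  | Sum.inl v => starOp v
  | Sum.inr p => faceOp p

/-- Configurations `f ∈ Ω = {1, -1}^W`. -/
abbrev SignConfig : Type := Site → ℤˣ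

/-- `Q_w(f) = ½ (1 + f(w) S_w)`. -/
noncomputable def siteProj (f : SignConfig) (w : Site) : Op :=
  (1 / 2 : ℂ) • (1 + ((f w : ℤ) : ℂ) • stabilizer w)

theorem stabilizer_comm (w w' : Site) : Commute (stabilizer w) (stabilizer w') := by
  have hX : ∀ v v', Commute (starOp v) (starOp v') := by
    intro v v'
    apply op_ext
    intro ψ c
    change starOp v (starOp v' ψ) c = starOp v' (starOp v ψ) c
    simp only [starOp_apply]
    rw [symmDiff_right_comm]
  have hZ : ∀ p p', Commute (faceOp p) (faceOp p') := by
    intro p p'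
    apply op_ext
    intro ψ c
    change faceOp p (faceOp p' ψ) c = faceOp p' (faceOp p ψ) c
    simp only [faceOp_apply]
    ring
  cases w <;> cases w'
  · exact hX _ _
  · exact starOp_faceOp_comm _ _
  · exact (starOp_faceOp_comm _ _).symm
  · exact hZ _ _

theorem siteProj_comm (f : SignConfig) (w w' : Site) :
    Commute (siteProj f w) (siteProj f w') := by
  have h := stabilizer_comm w w'
  refine Commute.smul_left (Commute.smul_right ?_ _) _
  refine Commute.add_left (Commute.one_left _) (Commute.add_right (Commute.one_right _) ?_)
  exact Commute.smul_left (Commute.smul_right h _) _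

/-- The edges on which `S_w` acts. -/
def support : Site → Finset Edge
  | Sum.inl v => vertexStar v
  | Sum.inr p => faceBoundary p

theorem support_subset_of_mem (Λ : Finset Edge) (w : Site) (h : stabilizer w ∈ localAlg Λ) :
    support w ⊆ Λ := by
  obtain ⟨a, ha⟩ := h
  change amplify Λ a = _ at ha
  intro e he
  by_contra heΛ
  cases w with
  | inl v =>
    have h1 : starOp v (basisVec (vertexStar v)) ∅ = 1 := by
      rw [starOp_apply, basisVec_apply, if_pos]
      exact bot_symmDiff _
    change amplify Λ a = starOp v at ha
    rw [← ha, amplify_apply, Finset.sum_eq_zero] at h1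
    · exact zero_ne_one h1
    · intro s _
      rw [basisVec_apply, if_neg, mul_zero]
      intro h2
      change e ∈ vertexStar v at he
      rw [← h2, glue, Finset.mem_union] at he
      rcases he with he | he
      · simp at he
      · exact heΛ (Finset.mem_powerset.1 s.2 he)
  | inr p =>
    change amplify Λ a = faceOp p at ha
    have hin : inside Λ {e} = inside Λ ∅ := by
      apply Subtype.ext
      simp [inside, heΛ]
    have key : ∀ c, faceOp p (basisVec c) c = a (inside Λ c) (inside Λ c) := by
      intro c
      rw [← ha, amplify_apply, Finset.sum_eq_single (inside Λ c)]
      · rw [glue_inside, basisVec_apply, if_pos rfl, mul_one]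
      · intro s _ hs
        rw [basisVec_apply, if_neg, mul_zero]
        intro h
        exact hs ((glue_eq_iff _ _ _ _).1 h).1
      · simp
    have h0 := key ∅
    have h1 := key {e}
    rw [hin, ← h0] at h1
    change e ∈ faceBoundary p at he
    simp only [faceOp_apply, basisVec_apply, if_true, mul_one, Finset.notMem_empty, if_false,
      Finset.prod_const_one, Finset.mem_singleton, Finset.prod_ite_eq', he] at h1
    norm_num at h1

theorem siteProj_mem_iff (f : SignConfig) (Λ : Finset Edge) (w : Site) :
    siteProj f w ∈ localAlg Λ ↔ stabilizer w ∈ localAlg Λ := by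
  have hf : ((f w : ℤ) : ℂ) * ((f w : ℤ) : ℂ) = 1 := by
    rcases Int.units_eq_one_or (f w) with h | h <;> simp [h]
  constructor
  · intro h
    have h2 : stabilizer w = ((f w : ℤ) : ℂ) • ((2 : ℂ) • siteProj f w - 1) := by
      rw [siteProj, smul_smul, smul_sub, smul_smul, smul_add, smul_smul]
      norm_num
      simp [hf]
    rw [h2]
    exact (localAlg Λ).smul_mem (sub_mem ((localAlg Λ).smul_mem h _) (one_mem _)) _
  · intro h
    exact (localAlg Λ).smul_mem (add_mem (one_mem _) ((localAlg Λ).smul_mem h _)) _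

theorem finite_siteProj_mem (f : SignConfig) (Λ : Finset Edge) :
    {w : Site | siteProj f w ∈ localAlg Λ}.Finite := by
  have hfin : Set.Finite ((Sum.inl '' ((fun e : Edge => (e.1, e.2.1)) '' (Λ : Set Edge)) ∪
      Sum.inr '' ((fun e : Edge => (e.1, e.2.1)) '' (Λ : Set Edge)) : Set Site)) :=
    ((Λ.finite_toSet.image _).image _).union ((Λ.finite_toSet.image _).image _)
  refine hfin.subset ?_
  intro w hw
  have hs := support_subset_of_mem Λ w ((siteProj_mem_iff f Λ w).1 hw)
  cases w with
  | inl v =>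
    refine Or.inl ⟨v, ⟨(v.1, v.2, false), hs ?_, rfl⟩, rfl⟩
    simp [support, vertexStar]
  | inr p =>
    refine Or.inr ⟨p, ⟨(p.1, p.2, false), hs ?_, rfl⟩, rfl⟩
    simp [support, faceBoundary]

/-- `P_Λ(f)`, the product of all the `Q_w(f)` that belong to `𝒜_Λ`. -/
noncomputable def groundProj (f : SignConfig) (Λ : Finset Edge) : Op :=
  (finite_siteProj_mem f Λ).toFinset.noncommProd (siteProj f)
    (fun _ _ _ _ _ => siteProj_comm f _ _)

/-! ### Nets of projections and local topological quantum order -/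

/-- A frustration-free net of proper (that is, non-zero) local projections, indexed by the finite
sets of edges: it decreases as the region grows. -/
structure IsFrustrationFreeNet (Q : Finset Edge → Op) : Prop where
  mem_localAlg : ∀ Λ, Q Λ ∈ localAlg Λ
  isStarProjection : ∀ Λ, IsStarProjection (Q Λ)
  ne_zero : ∀ Λ, Q Λ ≠ 0
  le_of_subset : ∀ Λ' Λ, Λ' ⊆ Λ → Q Λ ≤ Q Λ'

/-- `ω_Λ(X) = Tr(Q_Λ X Q_Λ) / Tr(Q_Λ)` for `X ∈ 𝒜_Λ`, with the trace over `H_Λ`. -/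
noncomputable def localState (Q : Finset Edge → Op) (Λ : Finset Edge) (X : Op) : ℂ :=
  localTrace Λ (Q Λ * X * Q Λ) / localTrace Λ (Q Λ)

/-- Local topological quantum order: `‖Q_Λ X Q_Λ - ω_Λ(X) Q_Λ‖ → 0` for every local observable
`X`, along the finite sets `Λ` of edges ordered by inclusion. -/
def IsLTQO (Q : Finset Edge → Op) : Prop :=
  ∀ X ∈ localObservables,
    Tendsto (fun Λ => ‖Q Λ * X * Q Λ - localState Q Λ X • Q Λ‖) atTop (𝓝 0)

end ToricCode

/-! Every observable on `Λ` is a linear combination of Pauli strings `xString a * zString b` with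
`a, b ⊆ Λ`, so it suffices to compress one string by `P_Δ(f)`. Two strings commute up to the sign
`overlapSign`. If `b` meets some star in an odd number of edges, or `a` some face boundary, then
that stabilizer anticommutes with the string. It acts on both sides of `P_Δ(f)` as the same scalar
`f w`, so the compression is zero (`prodProj_mul_mul_eq_zero`). Otherwise `b` is a mod 2 cycle and
`a` a mod 2 cocycle. The plane has no homology in degree one, so `b` is a sum of face boundaries
(`cycle_mem_span`) and, by duality, `a` is a sum of stars (`cocycle_mem_span`). The string is then a
product of stabilizers. Once `Δ` contains their supports, each acts on `P_Δ(f)` as a sign and the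
compression is again a scalar. A finite `Δ` serves all strings on `Λ`, because `Λ` has finitely many
subsets (`exists_enlargement`). The scalar must be `ω_Δ(X)`, as one sees by taking traces, and it
persists for every region containing `Δ`, so the limit is attained. The projections are non-zero for
every `f` because, in a finite set of sites, a single Pauli matrix can flip one stabilizer and leave
the others alone (`exists_flip`). Removing sites one at a time, `prodProj_ne_zero` shows that no
choice of signs is contradictory. -/

namespace ToricCode

/-! ### Cycles and cocycles of the square lattice, modulo 2 -/

/-- The mod 2 sums of the sets `g i`, `i ∈ I`. -/
inductive SymmDiffSpan {ι : Type*} (g : ι → Finset Edge) (I : Set ι) : Finset Edge → Prop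
  | empty : SymmDiffSpan g I ∅
  | step {a : Finset Edge} {i : ι} (ha : SymmDiffSpan g I a) (hi : i ∈ I) :
      SymmDiffSpan g I (symmDiff a (g i))

namespace SymmDiffSpan

variable {ι : Type*} {g : ι → Finset Edge} {I J : Set ι} {a b : Finset Edge}

theorem symmDiff (ha : SymmDiffSpan g I a) (hb : SymmDiffSpan g I b) :
    SymmDiffSpan g I (symmDiff a b) := by
  induction hb with
  | empty => exact (symmDiff_bot a).symm ▸ ha
  | step _ hi ih => rw [← symmDiff_assoc]; exact ih.step hi

theorem mono (ha : SymmDiffSpan g I a) (h : I ⊆ J) : SymmDiffSpan g J a := by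
  induction ha with
  | empty => exact empty
  | step _ hi ih => exact ih.step (h hi)

/-- A derivation uses finitely many generators. This is what lets a finite region contain all the
stabilizers of a given string. -/
theorem exists_finset (ha : SymmDiffSpan g I a) : ∃ S : Finset ι, SymmDiffSpan g S a := by
  classical
  induction ha with
  | empty => exact ⟨∅, empty⟩
  | @step a i _ hi ih =>
    obtain ⟨S, hS⟩ := ih
    exact ⟨insert i S, (hS.mono (by simp)).step (by simp)⟩

end SymmDiffSpan

/-- The parity `(-1) ^ #(a ∩ b)` of the overlap of two sets of edges. -/
def overlapSign (a b : Finset Edge) : ℂ := ∏ e ∈ a, if e ∈ b then -1 else 1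

theorem overlapSign_eq (a b : Finset Edge) : overlapSign a b = (-1) ^ (a ∩ b).card := by
  rw [overlapSign, Finset.prod_ite, Finset.prod_const_one, mul_one, Finset.prod_const,
    Finset.filter_mem_eq_inter]

theorem overlapSign_comm (a b : Finset Edge) : overlapSign a b = overlapSign b a := by
  rw [overlapSign_eq, overlapSign_eq, Finset.inter_comm]

theorem overlapSign_symmDiff (a b c : Finset Edge) :
    overlapSign a (symmDiff b c) = overlapSign a b * overlapSign a c := by
  rw [overlapSign, overlapSign, overlapSign, ← Finset.prod_mul_distrib]
  refine Finset.prod_congr rfl fun e _ => ?_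
  simp only [Finset.mem_symmDiff]
  by_cases h1 : e ∈ b <;> by_cases h2 : e ∈ c <;> simp [h1, h2]

theorem overlapSign_eq_or (a b : Finset Edge) : overlapSign a b = 1 ∨ overlapSign a b = -1 := by
  rw [overlapSign_eq]; exact neg_one_pow_eq_or ℂ _

theorem overlapSign_mul_self (a b : Finset Edge) : overlapSign a b * overlapSign a b = 1 := by
  rcases overlapSign_eq_or a b with h | h <;> simp [h]

theorem overlapSign_of_disjoint {a b : Finset Edge} (h : Disjoint a b) :
    overlapSign a b = 1 := by
  rw [overlapSign_eq, Finset.disjoint_iff_inter_eq_empty.1 h]; simp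

theorem overlapSign_empty (a : Finset Edge) : overlapSign a ∅ = 1 := by simp [overlapSign]

theorem overlapSign_singleton (a : Finset Edge) (e : Edge) :
    overlapSign a {e} = if e ∈ a then -1 else 1 := by
  rw [overlapSign_comm, overlapSign, Finset.prod_singleton]

theorem overlapSign_star_face (v : Vertex) (p : Face) :
    overlapSign (vertexStar v) (faceBoundary p) = 1 := by
  rw [overlapSign_comm]; exact prod_overlap v p

/-- All the vertical edges of `b` lie on the axis `x = 0`, so that `b` is contained in the comb
consisting of that axis and of all the horizontal edges, a spanning tree of the lattice. -/
def OnComb (b : Finset Edge) : Prop := ∀ x y, (x, y, true) ∈ b → x = 0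

theorem OnComb.symmDiff {a b : Finset Edge} (ha : OnComb a) (hb : OnComb b) :
    OnComb (symmDiff a b) := by
  intro x y h
  rcases Finset.mem_symmDiff.1 h with h | h
  exacts [ha _ _ h.1, hb _ _ h.1]

theorem onComb_horizontal (x y : ℤ) : OnComb {(x, y, false)} := by
  intro x' y' h; simp at h

theorem faceBoundary_eq (x y : ℤ) : faceBoundary (x, y) =
    symmDiff (symmDiff {(x, y, true)} {(x + 1, y, true)})
      (symmDiff {(x, y, false)} {(x, y + 1, false)}) := by
  ext e
  obtain ⟨x', y', b⟩ := e
  cases b <;> simp [faceBoundary, Finset.mem_symmDiff] <;> grind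

/-- Effect of adding a face: its vertical side `a` is traded for the opposite side `c` and the two
horizontal sides `d`. -/
theorem symmDiff_cancel_common (a b c d : Finset Edge) :
    symmDiff (symmDiff a b) (symmDiff (symmDiff a c) d) = symmDiff c (symmDiff b d) := by
  ext e
  simp only [Finset.mem_symmDiff]
  grind

/-- A horizontal edge is already on the comb. A vertical edge is pushed to the axis `x = 0` one face
at a time, each face leaving behind only its two horizontal sides. -/
theorem exists_onComb_singleton (e : Edge) :
    ∃ b, OnComb b ∧ SymmDiffSpan faceBoundary Set.univ (symmDiff {e} b) := by
  obtain ⟨x, y, d⟩ := e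
  have self : ∀ a : Finset Edge, SymmDiffSpan faceBoundary Set.univ (symmDiff a a) := fun a => by
    rw [symmDiff_self]; exact .empty
  cases d with
  | false => exact ⟨_, onComb_horizontal x y, self _⟩
  | true =>
    induction x using Int.induction_on with
    | zero => exact ⟨_, fun x' y' h => by simp at h; exact h.1, self {(0, y, true)}⟩
    | succ n ih =>
      obtain ⟨b, hb, hs⟩ := ih
      refine ⟨_, hb.symmDiff ((onComb_horizontal n y).symmDiff (onComb_horizontal n (y + 1))), ?_⟩
      have hs' := hs.step (Set.mem_univ ((n : ℤ), y))
      rw [faceBoundary_eq] at hs'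
      rwa [symmDiff_cancel_common] at hs'
    | pred n ih =>
      obtain ⟨b, hb, hs⟩ := ih
      refine ⟨_, hb.symmDiff ((onComb_horizontal (-n - 1) y).symmDiff
        (onComb_horizontal (-n - 1) (y + 1))), ?_⟩
      have hs' := hs.step (Set.mem_univ ((-n - 1 : ℤ), y))
      -- To the left of the axis the edge already treated is the right side of the face, so the two
      -- vertical sides are swapped before cancelling.
      rw [faceBoundary_eq, sub_add_cancel, symmDiff_comm {(-(n : ℤ) - 1, y, true)}] at hs'
      rwa [symmDiff_cancel_common] at hs'

theorem exists_onComb (a : Finset Edge) :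
    ∃ b, OnComb b ∧ SymmDiffSpan faceBoundary Set.univ (symmDiff a b) := by
  induction a using Finset.induction_on with
  | empty => exact ⟨∅, fun _ _ h => by simp at h, by rw [symmDiff_self]; exact .empty⟩
  | insert e a he ih =>
    obtain ⟨b, hb, hs⟩ := ih
    obtain ⟨c, hc, ht⟩ := exists_onComb_singleton e
    refine ⟨_, hc.symmDiff hb, ?_⟩
    convert ht.symmDiff hs using 1
    ext x; simp only [Finset.mem_symmDiff, Finset.mem_insert, Finset.mem_singleton]
    grind

/-- Membership that propagates along an injective sequence would make `s` infinite. -/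
theorem notMem_of_forall_succ {s : Finset Edge} (u : ℕ → Edge) (hu : Function.Injective u)
    (h : ∀ n, u n ∈ s → u (n + 1) ∈ s) : u 0 ∉ s := by
  intro h0
  have hall : ∀ n, u n ∈ s := fun n => Nat.rec h0 h n
  exact Set.infinite_range_of_injective hu
    (s.finite_toSet.subset (Set.range_subset_iff.2 hall))

/-- The parity condition at a vertex. -/
theorem cycle_at_vertex {b : Finset Edge} {x y : ℤ} (h : overlapSign (vertexStar (x, y)) b = 1) :
    (((x, y, false) ∈ b ↔ (x - 1, y, false) ∈ b) ↔
      ((x, y, true) ∈ b ↔ (x, y - 1, true) ∈ b)) := by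
  rw [overlapSign, vertexStar, Finset.prod_insert (by simp; omega),
    Finset.prod_insert (by simp), Finset.prod_insert (by simp; omega), Finset.prod_singleton] at h
  by_cases h1 : (x, y, false) ∈ b <;> by_cases h2 : (x - 1, y, false) ∈ b <;>
    by_cases h3 : (x, y, true) ∈ b <;> by_cases h4 : (x, y - 1, true) ∈ b <;>
    simp [h1, h2, h3, h4] at h ⊢ <;> norm_num at h

/-- The comb is a tree without finite cycles: off the axis, a horizontal edge forces its outward
neighbour, and so on to infinity. With the horizontal edges gone, the same happens upwards along the
axis. -/
theorem eq_empty_of_onComb {b : Finset Edge} (hb : OnComb b)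
    (h : ∀ v, overlapSign (vertexStar v) b = 1) : b = ∅ := by
  have hside : ∀ x y : ℤ, x ≠ 0 → ((x, y, false) ∈ b ↔ (x - 1, y, false) ∈ b) := by
    intro x y hx
    rw [cycle_at_vertex (h (x, y))]
    exact ⟨fun h => absurd (hb _ _ h) hx, fun h => absurd (hb _ _ h) hx⟩
  have hhor : ∀ x y : ℤ, (x, y, false) ∉ b := by
    intro x y
    rcases le_or_gt 0 x with hx | hx
    · have := notMem_of_forall_succ (s := b) (fun n : ℕ => (x + n, y, false))
        (fun m n hmn => by simpa using hmn) (fun n hn => by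
          rw [hside _ _ (by push_cast; omega)]
          convert hn using 2
          push_cast; ring)
      simpa using this
    · have := notMem_of_forall_succ (s := b) (fun n : ℕ => (x - n, y, false))
        (fun m n hmn => by simpa using hmn) (fun n hn => by
          have := (hside _ _ (by omega)).1 hn
          convert this using 2
          push_cast; ring)
      simpa using this
  have hver : ∀ y : ℤ, (0, y, true) ∉ b := by
    intro y
    have := notMem_of_forall_succ (s := b) (fun n : ℕ => (0, y + n, true))
      (fun m n hmn => by simpa using hmn) (fun n hn => by
        have := cycle_at_vertex (h (0, y + (n + 1 : ℕ)))
        simp only [hhor, true_iff] at this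
        refine this.2 ?_
        convert hn using 3
        push_cast; ring)
    simpa using this
  refine Finset.eq_empty_of_forall_notMem ?_
  rintro ⟨x, y, d⟩ hd
  cases d with
  | false => exact hhor x y hd
  | true => obtain rfl := hb x y hd; exact hver y hd

theorem overlapSign_eq_one_of_span {ι : Type*} {g : ι → Finset Edge} {I : Set ι}
    {a b : Finset Edge} (hb : SymmDiffSpan g I b) (h : ∀ i ∈ I, overlapSign a (g i) = 1) :
    overlapSign a b = 1 := by
  induction hb with
  | empty => exact overlapSign_empty a
  | step _ hi ih => rw [overlapSign_symmDiff, ih, h _ hi, mul_one]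

/-- Every finite cycle of the square lattice is a sum of face boundaries. -/
theorem cycle_mem_span {b : Finset Edge} (h : ∀ v, overlapSign (vertexStar v) b = 1) :
    SymmDiffSpan faceBoundary Set.univ b := by
  obtain ⟨c, hc, hs⟩ := exists_onComb b
  -- Face boundaries are cycles, so `c`, which differs from `b` by face boundaries, is a cycle on
  -- the comb.
  have hc0 : c = ∅ := by
    refine eq_empty_of_onComb hc fun v => ?_
    have := overlapSign_eq_one_of_span hs fun p _ => overlapSign_star_face v p
    rwa [overlapSign_symmDiff, h, one_mul] at this
  subst hc0
  convert hs
  exact (symmDiff_bot b).symm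

/-! ### Duality between cycles and cocycles -/

/-- The identification of the edges of the lattice with those of the dual lattice. -/
def dualEdge : Edge ≃ Edge where
  toFun | (x, y, false) => (x, y - 1, true) | (x, y, true) => (x - 1, y, false)
  invFun | (x, y, true) => (x, y + 1, false) | (x, y, false) => (x + 1, y, true)
  left_inv := by rintro ⟨x, y, _ | _⟩ <;> simp
  right_inv := by rintro ⟨x, y, _ | _⟩ <;> simp

/-- The dual of a set of edges. -/
def dual (a : Finset Edge) : Finset Edge := a.map dualEdge.toEmbedding

theorem mem_dual {a : Finset Edge} {e : Edge} : e ∈ dual a ↔ dualEdge.symm e ∈ a := by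
  simp [dual, Finset.mem_map_equiv]

theorem dual_injective : Function.Injective dual := Finset.map_injective _

theorem dual_symmDiff (a b : Finset Edge) : dual (symmDiff a b) = symmDiff (dual a) (dual b) := by
  ext e; simp only [mem_dual, Finset.mem_symmDiff]

theorem overlapSign_dual (a b : Finset Edge) : overlapSign (dual a) (dual b) = overlapSign a b := by
  rw [overlapSign_eq, overlapSign_eq, dual, dual, ← Finset.map_inter, Finset.card_map]

theorem dual_faceBoundary (p : Face) : dual (faceBoundary p) = vertexStar p := by
  obtain ⟨x, y⟩ := p
  ext ⟨x', y', d⟩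
  cases d <;> simp [mem_dual, dualEdge, faceBoundary, vertexStar] <;> grind

/-- The convention for `dualEdge` sends the boundary of the face `p` to the star of the vertex `p`,
so applying it to a star produces a diagonal shift. -/
theorem dual_vertexStar (v : Vertex) : dual (vertexStar v) = faceBoundary (v.1 - 1, v.2 - 1) := by
  obtain ⟨x, y⟩ := v
  ext ⟨x', y', d⟩
  cases d <;> simp [mem_dual, dualEdge, faceBoundary, vertexStar] <;> grind

/-- Every finite cocycle of the square lattice is a sum of stars. -/
theorem cocycle_mem_span {a : Finset Edge} (h : ∀ p, overlapSign (faceBoundary p) a = 1) :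
    SymmDiffSpan vertexStar Set.univ a := by
  -- A decomposition of `dual a` into faces is pulled back term by term. Each face `p` is the dual
  -- of the star at `p + (1, 1)`.
  have key : ∀ c, SymmDiffSpan faceBoundary Set.univ c → ∀ b, dual b = c →
      SymmDiffSpan vertexStar Set.univ b := by
    intro c hc
    induction hc with
    | empty =>
      intro b hb
      rw [show b = ∅ from dual_injective (by rw [hb]; rfl)]
      exact .empty
    | @step c p _ _ ih =>
      intro b hb
      have hv : dual (vertexStar (p.1 + 1, p.2 + 1)) = faceBoundary p := by
        rw [dual_vertexStar]; simp
      have hb' : b = symmDiff (symmDiff b (vertexStar (p.1 + 1, p.2 + 1)))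
          (vertexStar (p.1 + 1, p.2 + 1)) := (symmDiff_symmDiff_cancel_right _ _).symm
      rw [hb']
      refine (ih _ ?_).step (Set.mem_univ _)
      rw [dual_symmDiff, hb, hv, symmDiff_symmDiff_cancel_right]
  refine key _ (cycle_mem_span fun v => ?_) a rfl
  rw [← dual_faceBoundary, overlapSign_dual, h]

/-! ### Pauli strings -/

/-- The product of the `σ^x_e`, `e ∈ a`. -/
noncomputable def xString (a : Finset Edge) : Op :=
  a.noncommProd sigmaX (fun _ _ _ _ _ => sigmaX_comm _ _)

/-- The product of the `σ^z_e`, `e ∈ b`. -/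
noncomputable def zString (b : Finset Edge) : Op :=
  b.noncommProd sigmaZ (fun _ _ _ _ _ => sigmaZ_comm _ _)

theorem xString_apply (a : Finset Edge) (ψ : Hilb) (c : Finset Edge) :
    xString a ψ c = ψ (symmDiff c a) := prod_sigmaX_apply a ψ c

theorem zString_apply (b : Finset Edge) (ψ : Hilb) (c : Finset Edge) :
    zString b ψ c = overlapSign b c * ψ c := prod_sigmaZ_apply b ψ c

theorem mul_apply_apply (S T : Op) (ψ : Hilb) (c : Finset Edge) : (S * T) ψ c = S (T ψ) c := rfl

theorem smul_apply_apply (z : ℂ) (T : Op) (ψ : Hilb) (c : Finset Edge) :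
    (z • T) ψ c = z * T ψ c := rfl

theorem xString_mul (a b : Finset Edge) : xString a * xString b = xString (symmDiff a b) :=
  op_ext fun ψ c => by simp only [mul_apply_apply, xString_apply, symmDiff_assoc]

theorem zString_mul (a b : Finset Edge) : zString a * zString b = zString (symmDiff a b) :=
  op_ext fun ψ c => by
    simp only [mul_apply_apply, zString_apply, overlapSign_comm _ c, overlapSign_symmDiff, mul_assoc]

theorem xString_empty : xString ∅ = 1 :=
  op_ext fun ψ c => by rw [xString_apply]; exact congrArg ψ (symmDiff_bot c)

theorem zString_empty : zString ∅ = 1 :=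
  op_ext fun ψ c => by rw [zString_apply, overlapSign_comm, overlapSign_empty, one_mul]; rfl

theorem xString_mul_self (a : Finset Edge) : xString a * xString a = 1 := by
  rw [xString_mul, symmDiff_self]; exact xString_empty

theorem zString_mul_self (a : Finset Edge) : zString a * zString a = 1 := by
  rw [zString_mul, symmDiff_self]; exact zString_empty

theorem xString_comm (a b : Finset Edge) : xString a * xString b = xString b * xString a := by
  rw [xString_mul, xString_mul, symmDiff_comm]

theorem zString_comm (a b : Finset Edge) : zString a * zString b = zString b * zString a := by
  rw [zString_mul, zString_mul, symmDiff_comm]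

theorem zString_mul_xString (a b : Finset Edge) :
    zString b * xString a = overlapSign b a • (xString a * zString b) :=
  op_ext fun ψ c => by
    simp only [mul_apply_apply, smul_apply_apply, xString_apply, zString_apply,
      overlapSign_symmDiff]
    linear_combination (-overlapSign b c * ψ (symmDiff c a)) * overlapSign_mul_self b a

theorem xString_mul_zString (a b : Finset Edge) :
    xString a * zString b = overlapSign a b • (zString b * xString a) := by
  rw [zString_mul_xString, smul_smul, overlapSign_comm a b, overlapSign_mul_self, one_smul]

theorem xString_eq_amplify {a Λ : Finset Edge} (h : a ⊆ Λ) :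
    xString a = amplify Λ (Matrix.of fun s t => if symmDiff (s : Finset Edge) t = a then 1 else 0) := by
  apply op_ext
  intro ψ c
  have hm : symmDiff (c ∩ Λ) a ∈ Λ.powerset := by
    rw [Finset.mem_powerset]
    intro e he
    have := @h e
    simp only [Finset.mem_symmDiff, Finset.mem_inter] at he
    tauto
  rw [xString_apply, amplify_apply, Finset.sum_eq_single ⟨_, hm⟩]
  · rw [Matrix.of_apply, if_pos (by exact symmDiff_symmDiff_cancel_left (c ∩ Λ) a), one_mul]
    refine congrArg (fun d => ψ d) ?_
    ext e
    have := @h e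
    simp only [glue, Finset.mem_symmDiff, Finset.mem_inter, Finset.mem_union, Finset.mem_sdiff]
    tauto
  · intro s _ hs
    rw [Matrix.of_apply, if_neg, zero_mul]
    intro h'
    refine hs (Subtype.ext ?_)
    change (s : Finset Edge) = symmDiff (c ∩ Λ) a
    rw [← h']
    exact (symmDiff_symmDiff_cancel_left (c ∩ Λ) (s : Finset Edge)).symm
  · simp

theorem zString_eq_amplify {b Λ : Finset Edge} (h : b ⊆ Λ) :
    zString b = amplify Λ (Matrix.diagonal fun s => overlapSign b s) := by
  apply op_ext
  intro ψ c
  rw [zString_apply, amplify_apply, Finset.sum_eq_single (inside Λ c)]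
  · rw [Matrix.diagonal_apply_eq, glue_inside]
    congr 1
    refine Finset.prod_congr rfl fun e he => ?_
    simp [inside, h he]
  · intro s _ hs
    rw [Matrix.diagonal_apply_ne _ (Ne.symm hs), zero_mul]
  · simp

theorem xString_mem_localAlg {a Λ : Finset Edge} (h : a ⊆ Λ) : xString a ∈ localAlg Λ :=
  ⟨_, (xString_eq_amplify h).symm⟩

theorem zString_mem_localAlg {b Λ : Finset Edge} (h : b ⊆ Λ) : zString b ∈ localAlg Λ :=
  ⟨_, (zString_eq_amplify h).symm⟩

theorem isSelfAdjoint_xString (a : Finset Edge) : IsSelfAdjoint (xString a) := by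
  rw [IsSelfAdjoint, xString_eq_amplify (Finset.Subset.refl a), ← map_star]
  congr 1
  ext s t
  rw [Matrix.star_apply, Matrix.of_apply, Matrix.of_apply, symmDiff_comm]
  split_ifs <;> simp

theorem isSelfAdjoint_zString (b : Finset Edge) : IsSelfAdjoint (zString b) := by
  rw [IsSelfAdjoint, zString_eq_amplify (Finset.Subset.refl b), ← map_star]
  congr 1
  rw [Matrix.star_eq_conjTranspose, Matrix.diagonal_conjTranspose]
  congr 1
  funext s
  rcases overlapSign_eq_or b s with h | h <;> simp [h]

/-! ### Pauli strings span the local algebras -/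

/-- Orthogonality of the characters of `(ℤ/2)^Λ`: the sum factors into terms `1 + (±1)`, one for
each edge. A term is `2` where `c` and `t` agree and `0` where they differ. -/
theorem sum_overlapSign (Λ c : Finset Edge) (t : Λ.powerset) :
    ∑ b ∈ Λ.powerset, overlapSign b t * overlapSign b c =
      if inside Λ c = t then (2 : ℂ) ^ Λ.card else 0 := by
  have h : ∀ b, overlapSign b t * overlapSign b c =
      ∏ e ∈ b, ((if e ∈ (t : Finset Edge) then (-1 : ℂ) else 1) * (if e ∈ c then -1 else 1)) :=
    fun b => Finset.prod_mul_distrib.symm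
  simp only [h]
  rw [← Finset.prod_one_add]
  split_ifs with hc
  · subst hc
    rw [← Finset.prod_const]
    refine Finset.prod_congr rfl fun e he => ?_
    by_cases hec : e ∈ c <;> simp [inside, he, hec] <;> norm_num
  · obtain ⟨e, he⟩ : ∃ e ∈ Λ, ¬(e ∈ c ↔ e ∈ (t : Finset Edge)) := by
      by_contra! hcon
      refine hc (Subtype.ext ?_)
      ext e
      have h1 := hcon e
      have h2 : e ∈ (t : Finset Edge) → e ∈ Λ := fun h => Finset.mem_powerset.1 t.2 h
      simp only [inside, Finset.mem_inter]
      tauto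
    refine Finset.prod_eq_zero he.1 ?_
    by_cases h1 : e ∈ c <;> by_cases h2 : e ∈ (t : Finset Edge) <;> simp [h1, h2] at he ⊢

theorem sum_apply_apply {ι : Type*} (s : Finset ι) (T : ι → Op) (ψ : Hilb) (c : Finset Edge) :
    (∑ i ∈ s, T i) ψ c = ∑ i ∈ s, T i ψ c := by
  rw [sum_apply, lp.coeFn_sum, Finset.sum_apply]

/-- The matrix units are combinations of Pauli strings. -/
theorem amplify_single (Λ : Finset Edge) (s t : Λ.powerset) :
    amplify Λ (Matrix.single s t 1) = ((2 : ℂ) ^ Λ.card)⁻¹ • ∑ b ∈ Λ.powerset,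
      overlapSign b t • (xString (symmDiff s t) * zString b) := by
  apply op_ext
  intro ψ c
  have hs : ∀ e, e ∈ (s : Finset Edge) → e ∈ Λ := fun _ h => Finset.mem_powerset.1 s.2 h
  have ht : ∀ e, e ∈ (t : Finset Edge) → e ∈ Λ := fun _ h => Finset.mem_powerset.1 t.2 h
  -- The Fourier sum of the `zString b` is the projection onto `t`, and the `xString` then moves `t`
  -- to `s`. The condition tested after the shift is therefore that `c` agrees with `s` on `Λ`.
  have hiff : inside Λ (symmDiff c (symmDiff s t)) = t ↔ s = inside Λ c := by
    simp only [Subtype.ext_iff, Finset.ext_iff, inside, Finset.mem_inter, Finset.mem_symmDiff]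
    refine forall_congr' fun e => ?_
    have := hs e
    have := ht e
    tauto
  rw [smul_apply_apply, sum_apply_apply, amplify_apply, Finset.sum_eq_single t]
  · simp only [smul_apply_apply, mul_apply_apply, xString_apply, zString_apply, ← mul_assoc]
    rw [← Finset.sum_mul, sum_overlapSign, Matrix.single_apply]
    by_cases hc : s = inside Λ c
    · rw [if_pos ⟨hc, rfl⟩, if_pos (hiff.2 hc), one_mul, ← mul_assoc,
        inv_mul_cancel₀ (pow_ne_zero _ two_ne_zero), one_mul]
      refine congrArg (fun d => ψ d) ?_
      subst hc
      ext e
      have := ht e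
      simp only [glue, inside, Finset.mem_symmDiff, Finset.mem_inter, Finset.mem_union,
        Finset.mem_sdiff]
      tauto
    · rw [if_neg (fun h => hc h.1), if_neg (fun h => hc (hiff.1 h))]
      simp
  · intro r _ hr
    rw [Matrix.single_apply, if_neg (fun h => hr h.2.symm), zero_mul]
  · simp

theorem localAlg_le_span (Λ : Finset Edge) {X : Op} (hX : X ∈ localAlg Λ) :
    X ∈ Submodule.span ℂ {T : Op | ∃ a ⊆ Λ, ∃ b ⊆ Λ, T = xString a * zString b} := by
  obtain ⟨M, rfl⟩ := hX
  change amplify Λ M ∈ _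
  rw [Matrix.matrix_eq_sum_single M, map_sum]
  refine Submodule.sum_mem _ fun s _ => ?_
  rw [map_sum]
  refine Submodule.sum_mem _ fun t _ => ?_
  rw [show Matrix.single s t (M s t) = M s t • Matrix.single s t (1 : ℂ) by
    rw [Matrix.smul_single, smul_eq_mul, mul_one], map_smul, amplify_single]
  refine Submodule.smul_mem _ _ (Submodule.smul_mem _ _ (Submodule.sum_mem _ fun b hb => ?_))
  refine Submodule.smul_mem _ _ (Submodule.subset_span ⟨_, ?_, b, Finset.mem_powerset.1 hb, rfl⟩)
  have hs := Finset.mem_powerset.1 s.2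
  have ht := Finset.mem_powerset.1 t.2
  exact Finset.Subset.trans Finset.symmDiff_subset_union (Finset.union_subset hs ht)

/-! ### Stabilizers and their spectral projections -/

theorem stabilizer_mem_localAlg_iff (Λ : Finset Edge) (w : Site) :
    stabilizer w ∈ localAlg Λ ↔ support w ⊆ Λ := by
  refine ⟨support_subset_of_mem Λ w, fun h => ?_⟩
  cases w with
  | inl v => exact xString_mem_localAlg h
  | inr p => exact zString_mem_localAlg h

theorem stabilizer_mul_self (w : Site) : stabilizer w * stabilizer w = 1 := by
  cases w with
  | inl v => exact xString_mul_self _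
  | inr p => exact zString_mul_self _

theorem isSelfAdjoint_stabilizer (w : Site) : IsSelfAdjoint (stabilizer w) := by
  cases w with
  | inl v => exact isSelfAdjoint_xString _
  | inr p => exact isSelfAdjoint_zString _

theorem sign_mul_self (f : SignConfig) (w : Site) : ((f w : ℤ) : ℂ) * ((f w : ℤ) : ℂ) = 1 := by
  rcases Int.units_eq_one_or (f w) with h | h <;> simp [h]

theorem stabilizer_mul_siteProj (f : SignConfig) (w : Site) :
    stabilizer w * siteProj f w = ((f w : ℤ) : ℂ) • siteProj f w := by
  rw [siteProj, mul_smul_comm, mul_add, mul_smul_comm, stabilizer_mul_self, mul_one,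
    smul_comm ((f w : ℤ) : ℂ), smul_add ((f w : ℤ) : ℂ), smul_smul ((f w : ℤ) : ℂ),
    sign_mul_self, one_smul, add_comm]

theorem isStarProjection_siteProj (f : SignConfig) (w : Site) :
    IsStarProjection (siteProj f w) where
  isIdempotentElem := by
    rw [IsIdempotentElem]
    nth_rw 1 [siteProj]
    rw [smul_mul_assoc, add_mul, smul_mul_assoc, stabilizer_mul_siteProj, smul_smul,
      sign_mul_self, one_mul, one_smul, ← two_smul ℂ, smul_smul]
    norm_num
  isSelfAdjoint := by
    rw [IsSelfAdjoint, siteProj, star_smul, star_add, star_smul, star_one,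
      (isSelfAdjoint_stabilizer w).star_eq]
    simp

/-- The product of the commuting projections `Q_w(f)`, `w ∈ F`. -/
noncomputable def prodProj (f : SignConfig) (F : Finset Site) : Op :=
  F.noncommProd (siteProj f) (fun _ _ _ _ _ => siteProj_comm f _ _)

theorem prodProj_insert (f : SignConfig) {F : Finset Site} {w : Site} (h : w ∉ F) :
    prodProj f (insert w F) = siteProj f w * prodProj f F :=
  Finset.noncommProd_insert_of_notMem F w _ _ h

theorem prodProj_empty (f : SignConfig) : prodProj f ∅ = 1 := Finset.noncommProd_empty _ _

theorem siteProj_mul_prodProj (f : SignConfig) {F : Finset Site} {w : Site} (h : w ∈ F) :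
    siteProj f w * prodProj f F = prodProj f F := by
  rw [← Finset.insert_erase h, prodProj_insert f (Finset.notMem_erase w F), ← mul_assoc,
    (isStarProjection_siteProj f w).isIdempotentElem.eq]

theorem commute_prodProj (f : SignConfig) {T : Op} {F : Finset Site}
    (h : ∀ w ∈ F, Commute T (siteProj f w)) : Commute T (prodProj f F) :=
  Finset.noncommProd_commute _ _ _ _ h

theorem isStarProjection_prodProj (f : SignConfig) (F : Finset Site) :
    IsStarProjection (prodProj f F) := by
  induction F using Finset.induction_on with
  | empty => rw [prodProj_empty]; exact .one _
  | insert w F h ih =>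
    have hc : Commute (siteProj f w) (prodProj f F) :=
      commute_prodProj f fun _ _ => siteProj_comm f _ _
    have hw := isStarProjection_siteProj f w
    rw [prodProj_insert f h]
    exact ⟨hw.isIdempotentElem.mul_of_commute hc ih.isIdempotentElem,
      (hw.isSelfAdjoint.commute_iff ih.isSelfAdjoint).1 hc⟩

theorem prodProj_mul_prodProj (f : SignConfig) {F G : Finset Site} (h : G ⊆ F) :
    prodProj f G * prodProj f F = prodProj f F :=
  Finset.noncommProd_induction G (siteProj f) _ (fun T : Op => T * prodProj f F = prodProj f F)
    (fun S T hS hT => by rw [mul_assoc, hT, hS]) (one_mul _)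
    fun _ hw => siteProj_mul_prodProj f (h hw)

theorem stabilizer_mul_prodProj (f : SignConfig) {F : Finset Site} {w : Site} (h : w ∈ F) :
    stabilizer w * prodProj f F = ((f w : ℤ) : ℂ) • prodProj f F := by
  rw [← siteProj_mul_prodProj f h, ← mul_assoc, stabilizer_mul_siteProj, smul_mul_assoc]

theorem prodProj_mul_stabilizer (f : SignConfig) {F : Finset Site} {w : Site} (h : w ∈ F) :
    prodProj f F * stabilizer w = ((f w : ℤ) : ℂ) • prodProj f F := by
  have hS : Commute (stabilizer w) (prodProj f F) := by
    refine commute_prodProj f fun w' _ => ?_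
    refine Commute.smul_right (Commute.add_right (Commute.one_right _) ?_) _
    exact Commute.smul_right (stabilizer_comm w w') _
  rw [← hS.eq, stabilizer_mul_prodProj f h]

/-! ### Sign arguments: vanishing compressions, non-vanishing products -/

theorem eq_zero_of_eq_neg {T : Op} (h : T = -T) : T = 0 := by
  have h2 : (2 : ℂ) • T = 0 := by
    rw [two_smul]
    nth_rw 2 [h]
    exact add_neg_cancel T
  exact (smul_eq_zero.1 h2).resolve_left two_ne_zero

/-- The stabilizer can be absorbed into the projection on the left or, after anticommuting past `U`,
on the right. Both give the scalar `f w`, so the compression equals its own negative. -/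
theorem prodProj_mul_mul_eq_zero (f : SignConfig) {F : Finset Site} {w : Site} (h : w ∈ F)
    {U : Op} (hU : stabilizer w * U = -(U * stabilizer w)) :
    prodProj f F * U * prodProj f F = 0 := by
  have h1 : prodProj f F * (stabilizer w * U) * prodProj f F =
      ((f w : ℤ) : ℂ) • (prodProj f F * U * prodProj f F) := by
    rw [← mul_assoc, prodProj_mul_stabilizer f h, smul_mul_assoc, smul_mul_assoc]
  have h2 : prodProj f F * (stabilizer w * U) * prodProj f F =
      -(((f w : ℤ) : ℂ) • (prodProj f F * U * prodProj f F)) := by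
    rw [hU, mul_neg, neg_mul, mul_assoc, mul_assoc, stabilizer_mul_prodProj f h, mul_smul_comm,
      mul_smul_comm, mul_assoc]
  have h3 := eq_zero_of_eq_neg (h1.symm.trans (h2.trans (congrArg _ rfl)))
  refine (smul_eq_zero.1 h3).resolve_left fun h0 => ?_
  simpa [h0] using sign_mul_self f w

/-- In a finite set of sites, the rightmost stabilizer can be flipped by an operator that commutes
with all the others. -/
theorem exists_flip (F : Finset Site) (hF : F.Nonempty) :
    ∃ w ∈ F, ∃ U : Op, U * U = 1 ∧ U * stabilizer w = -(stabilizer w * U) ∧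
      ∀ w' ∈ F, w' ≠ w → U * stabilizer w' = stabilizer w' * U := by
  obtain ⟨w, hw, hmax⟩ := F.exists_max_image (Sum.elim Prod.fst Prod.fst : Site → ℤ) hF
  refine ⟨w, hw, ?_⟩
  cases w with
  | inl v =>
    obtain ⟨x, y⟩ := v
    -- The right edge of the star lies in only one other star, that of `(x + 1, y)`, which is not in
    -- `F` because `x` is maximal.
    refine ⟨zString {(x, y, false)}, zString_mul_self _, ?_, ?_⟩
    · change _ * xString _ = -(xString _ * _)
      rw [zString_mul_xString, overlapSign_comm, overlapSign_singleton,
        if_pos (by simp [vertexStar]), neg_one_smul]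
    · rintro (⟨x', y'⟩ | p) hw' hne
      · change _ * xString _ = xString _ * _
        rw [zString_mul_xString, overlapSign_comm, overlapSign_singleton, if_neg, one_smul]
        have := hmax _ hw'
        simp at this hne
        simp [vertexStar]
        grind
      · exact zString_comm _ _
  | inr p =>
    obtain ⟨x, y⟩ := p
    -- Likewise the right side of the face is shared only with the face `(x + 1, y)`.
    refine ⟨xString {(x + 1, y, true)}, xString_mul_self _, ?_, ?_⟩
    · change _ * zString _ = -(zString _ * _)
      rw [xString_mul_zString, overlapSign_comm, overlapSign_singleton,
        if_pos (by simp [faceBoundary]), neg_one_smul]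
    · rintro (v | ⟨x', y'⟩) hw' hne
      · exact xString_comm _ _
      · change _ * zString _ = zString _ * _
        rw [xString_mul_zString, overlapSign_comm, overlapSign_singleton, if_neg, one_smul]
        have := hmax _ hw'
        simp at this hne
        simp [faceBoundary]
        grind

theorem prodProj_ne_zero (f : SignConfig) (F : Finset Site) : prodProj f F ≠ 0 := by
  induction F using Finset.strongInduction with
  | H F ih =>
    rcases F.eq_empty_or_nonempty with rfl | hF
    · rw [prodProj_empty]
      intro h
      have := congrArg (fun T : Op => T (basisVec ∅) ∅) h
      change basisVec ∅ ∅ = 0 at this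
      simp [basisVec_apply] at this
    · obtain ⟨w, hw, U, hUU, hUw, hUF⟩ := exists_flip F hF
      intro h0
      rw [← Finset.insert_erase hw, prodProj_insert f (Finset.notMem_erase w F)] at h0
      refine ih (F.erase w) (Finset.erase_ssubset hw) ?_
      set P := prodProj f (F.erase w)
      have hUP : U * P = P * U := by
        refine (commute_prodProj f fun w' hw' => ?_).eq
        obtain ⟨hne, hm⟩ := Finset.mem_erase.1 hw'
        refine Commute.smul_right (Commute.add_right (Commute.one_right _) ?_) _
        exact Commute.smul_right (hUF w' hm hne) _
      -- If `siteProj f w` kills `P`, then `P` lies in the opposite eigenspace of the stabilizer.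
      -- Conjugation by `U` fixes `P` and flips that eigenvalue, so `P = -P`.
      have h1 : P = -(((f w : ℤ) : ℂ) • (stabilizer w * P)) := by
        rw [siteProj, smul_mul_assoc, smul_eq_zero] at h0
        have := h0.resolve_left (by norm_num)
        rw [add_mul, one_mul, smul_mul_assoc] at this
        exact eq_neg_of_add_eq_zero_left this
      refine eq_zero_of_eq_neg ?_
      calc P = U * P * U := by rw [hUP, mul_assoc, hUU, mul_one]
        _ = ((f w : ℤ) : ℂ) • (stabilizer w * U * P * U) := by
            nth_rw 1 [h1]
            rw [mul_neg, mul_smul_comm, ← mul_assoc, hUw, neg_mul (stabilizer w * U), smul_neg,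
              neg_neg, smul_mul_assoc]
        _ = ((f w : ℤ) : ℂ) • (stabilizer w * P) := by
            rw [mul_assoc (stabilizer w), hUP, mul_assoc, mul_assoc, hUU, mul_one]
        _ = -P := by nth_rw 2 [h1]; rw [neg_neg]

/-! ### The net of ground state projections -/

/-- Membership of `siteProj f w` in `localAlg Λ` is thus a condition on supports alone, independent
of `f`. -/
theorem mem_sites_iff (f : SignConfig) (Λ : Finset Edge) (w : Site) :
    w ∈ (finite_siteProj_mem f Λ).toFinset ↔ support w ⊆ Λ := by
  rw [Set.Finite.mem_toFinset, Set.mem_ofPred_eq, siteProj_mem_iff, stabilizer_mem_localAlg_iff]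

theorem groundProj_mem_localAlg (f : SignConfig) (Λ : Finset Edge) :
    groundProj f Λ ∈ localAlg Λ :=
  Finset.noncommProd_induction _ (siteProj f) _ (fun T : Op => T ∈ localAlg Λ)
    (fun _ _ => mul_mem) (one_mem _) fun w hw => by
      simpa using hw

theorem groundProj_mul_groundProj (f : SignConfig) {Λ' Λ : Finset Edge} (h : Λ' ⊆ Λ) :
    groundProj f Λ' * groundProj f Λ = groundProj f Λ :=
  prodProj_mul_prodProj f fun w hw =>
    (mem_sites_iff f Λ w).2 (((mem_sites_iff f Λ' w).1 hw).trans h)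

theorem groundProj_mul_groundProj' (f : SignConfig) {Λ' Λ : Finset Edge} (h : Λ' ⊆ Λ) :
    groundProj f Λ * groundProj f Λ' = groundProj f Λ := by
  have hs : ∀ Λ, star (groundProj f Λ) = groundProj f Λ :=
    fun Λ => (isStarProjection_prodProj f _).isSelfAdjoint.star_eq
  rw [← hs Λ, ← hs Λ', ← star_mul, groundProj_mul_groundProj f h]

theorem isFrustrationFreeNet_groundProj (f : SignConfig) :
    IsFrustrationFreeNet (groundProj f) where
  mem_localAlg := groundProj_mem_localAlg f
  isStarProjection _ := isStarProjection_prodProj f _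
  ne_zero _ := prodProj_ne_zero f _
  le_of_subset _ _ h := (isStarProjection_prodProj f _).le_of_mul_eq_right
    (isStarProjection_prodProj f _) (groundProj_mul_groundProj f h)

/-- The projection is the image of `Mᴴ * M`, whose trace vanishes only when `M = 0`. -/
theorem localTrace_groundProj_ne_zero (f : SignConfig) (Λ : Finset Edge) :
    localTrace Λ (groundProj f Λ) ≠ 0 := by
  have hP : IsStarProjection (groundProj f Λ) := isStarProjection_prodProj f _
  obtain ⟨M, hM⟩ := groundProj_mem_localAlg f Λ
  change amplify Λ M = _ at hM
  have h : groundProj f Λ = amplify Λ (M.conjTranspose * M) := by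
    rw [map_mul, ← Matrix.star_eq_conjTranspose, map_star, hM, hP.isSelfAdjoint.star_eq,
      hP.isIdempotentElem.eq]
  rw [h, localTrace_amplify]
  intro h0
  open ComplexOrder in
  rw [Matrix.trace_conjTranspose_mul_self_eq_zero_iff] at h0
  rw [h0, map_zero] at hM
  exact prodProj_ne_zero f _ hM.symm

theorem localTrace_smul (Λ : Finset Edge) (z : ℂ) (T : Op) :
    localTrace Λ (z • T) = z * localTrace Λ T := by
  simp only [localTrace, inner_basisVec, smul_apply_apply, Finset.mul_sum]

theorem localState_eq (f : SignConfig) {Λ : Finset Edge} {X : Op} {z : ℂ}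
    (h : groundProj f Λ * X * groundProj f Λ = z • groundProj f Λ) :
    localState (groundProj f) Λ X = z := by
  rw [localState, h, localTrace_smul, mul_div_cancel_right₀ _ (localTrace_groundProj_ne_zero f Λ)]

/-! ### Topological order -/

theorem exists_xString_mul_prodProj (f : SignConfig) {F : Finset Site} {S : Set Vertex}
    (hS : ∀ v ∈ S, Sum.inl v ∈ F) {a : Finset Edge} (ha : SymmDiffSpan vertexStar S a) :
    ∃ z : ℂ, xString a * prodProj f F = z • prodProj f F := by
  induction ha with
  | empty => exact ⟨1, by rw [xString_empty, one_mul, one_smul]⟩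
  | @step a v _ hv ih =>
    obtain ⟨z, hz⟩ := ih
    refine ⟨((f (Sum.inl v) : ℤ) : ℂ) * z, ?_⟩
    have hw : xString (vertexStar v) * prodProj f F = _ := stabilizer_mul_prodProj f (hS v hv)
    rw [← xString_mul, mul_assoc, hw, mul_smul_comm, hz, smul_smul]

theorem exists_zString_mul_prodProj (f : SignConfig) {F : Finset Site} {S : Set Face}
    (hS : ∀ p ∈ S, Sum.inr p ∈ F) {b : Finset Edge} (hb : SymmDiffSpan faceBoundary S b) :
    ∃ z : ℂ, zString b * prodProj f F = z • prodProj f F := by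
  induction hb with
  | empty => exact ⟨1, by rw [zString_empty, one_mul, one_smul]⟩
  | @step b p _ hp ih =>
    obtain ⟨z, hz⟩ := ih
    refine ⟨((f (Sum.inr p) : ℤ) : ℂ) * z, ?_⟩
    have hw : zString (faceBoundary p) * prodProj f F = _ := stabilizer_mul_prodProj f (hS p hp)
    rw [← zString_mul, mul_assoc, hw, mul_smul_comm, hz, smul_smul]

theorem not_disjoint_of_overlapSign_ne {a b : Finset Edge} (h : overlapSign a b ≠ 1) :
    ¬Disjoint a b := fun hd => h (overlapSign_of_disjoint hd)

theorem overlapSign_eq_neg_one {a b : Finset Edge} (h : overlapSign a b ≠ 1) :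
    overlapSign a b = -1 := (overlapSign_eq_or a b).resolve_left h

theorem exists_pauli_compression (f : SignConfig) {Δ a b : Finset Edge}
    (hstar : ∀ v, ¬Disjoint (vertexStar v) b → vertexStar v ⊆ Δ)
    (hface : ∀ p, ¬Disjoint (faceBoundary p) a → faceBoundary p ⊆ Δ)
    (ha : (∀ p, overlapSign (faceBoundary p) a = 1) →
      SymmDiffSpan vertexStar {v | vertexStar v ⊆ Δ} a)
    (hb : (∀ v, overlapSign (vertexStar v) b = 1) →
      SymmDiffSpan faceBoundary {p | faceBoundary p ⊆ Δ} b) :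
    ∃ z : ℂ, groundProj f Δ * (xString a * zString b) * groundProj f Δ = z • groundProj f Δ := by
  by_cases hb' : ∀ v, overlapSign (vertexStar v) b = 1
  · by_cases ha' : ∀ p, overlapSign (faceBoundary p) a = 1
    · obtain ⟨x, hx⟩ := exists_xString_mul_prodProj f
        (fun v hv => (mem_sites_iff f Δ (Sum.inl v)).2 hv) (ha ha')
      obtain ⟨z, hz⟩ := exists_zString_mul_prodProj f
        (fun p hp => (mem_sites_iff f Δ (Sum.inr p)).2 hp) (hb hb')
      refine ⟨z * x, ?_⟩
      -- `groundProj f Δ` unfolds to `prodProj f` over the sites with support in `Δ`.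
      change prodProj f _ * _ * prodProj f _ = (z * x) • prodProj f _
      rw [mul_assoc, mul_assoc, hz, mul_smul_comm, hx, mul_smul_comm, mul_smul_comm,
        (isStarProjection_prodProj f _).isIdempotentElem.eq, smul_smul]
    · push Not at ha'
      obtain ⟨p, hp⟩ := ha'
      refine ⟨0, ?_⟩
      rw [zero_smul]
      refine prodProj_mul_mul_eq_zero f ((mem_sites_iff f Δ (Sum.inr p)).2
        (hface p (not_disjoint_of_overlapSign_ne hp))) ?_
      change zString _ * _ = -(_ * zString _)
      rw [← mul_assoc, zString_mul_xString, overlapSign_eq_neg_one hp, neg_one_smul, neg_mul,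
        mul_assoc, zString_comm, mul_assoc]
  · push Not at hb'
    obtain ⟨v, hv⟩ := hb'
    refine ⟨0, ?_⟩
    rw [zero_smul]
    refine prodProj_mul_mul_eq_zero f ((mem_sites_iff f Δ (Sum.inl v)).2
      (hstar v (not_disjoint_of_overlapSign_ne hv))) ?_
    change xString _ * _ = -(_ * xString _)
    rw [← mul_assoc, xString_comm, mul_assoc, xString_mul_zString, overlapSign_eq_neg_one hv,
      neg_one_smul, mul_neg, mul_assoc]

/-- The union of the stars and face boundaries within unit distance of the edge `e`. -/
noncomputable def edgeNeighborhood (e : Edge) : Finset Edge :=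
  (Finset.Icc (e.1 - 1) (e.1 + 1) ×ˢ Finset.Icc (e.2.1 - 1) (e.2.1 + 1)).biUnion
    fun q => vertexStar q ∪ faceBoundary q

theorem support_subset_edgeNeighborhood {w : Site} {e : Edge} (h : e ∈ support w) :
    support w ⊆ edgeNeighborhood e := by
  obtain ⟨x, y, d⟩ := e
  have key : ∀ q : ℤ × ℤ, (q.1 ∈ Finset.Icc (x - 1) (x + 1) ∧ q.2 ∈ Finset.Icc (y - 1) (y + 1)) →
      vertexStar q ∪ faceBoundary q ⊆ edgeNeighborhood (x, y, d) := fun q hq =>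
    Finset.subset_biUnion_of_mem (fun q => vertexStar q ∪ faceBoundary q)
      (Finset.mem_product.2 hq)
  rcases w with ⟨x', y'⟩ | ⟨x', y'⟩
  · refine Finset.subset_union_left.trans (key (x', y') ?_)
    simp only [Finset.mem_Icc]
    cases d <;> simp [support, vertexStar] at h <;> omega
  · refine Finset.subset_union_right.trans (key (x', y') ?_)
    simp only [Finset.mem_Icc]
    cases d <;> simp [support, faceBoundary] at h <;> omega

/-- `Δ` must hold the stabilizers that can detect a string on `Λ`, hence the edge neighborhoods, and
those that generate the undetected ones, hence the chosen decompositions of all subsets of `Λ`. -/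
theorem exists_enlargement (Λ : Finset Edge) : ∃ Δ : Finset Edge, Λ ⊆ Δ ∧
    (∀ w : Site, ¬Disjoint (support w) Λ → support w ⊆ Δ) ∧
    (∀ a ⊆ Λ, (∀ p, overlapSign (faceBoundary p) a = 1) →
      SymmDiffSpan vertexStar {v | vertexStar v ⊆ Δ} a) ∧
    (∀ b ⊆ Λ, (∀ v, overlapSign (vertexStar v) b = 1) →
      SymmDiffSpan faceBoundary {p | faceBoundary p ⊆ Δ} b) := by
  -- The cocycle condition is kept inside the existential so that a witness can be chosen for every
  -- `a`; where it fails, `∅` is a dummy value.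
  have hA : ∀ a, ∃ S : Finset Vertex, (∀ p, overlapSign (faceBoundary p) a = 1) →
      SymmDiffSpan vertexStar S a := fun a => by
    by_cases h : ∀ p, overlapSign (faceBoundary p) a = 1
    · obtain ⟨S, hS⟩ := (cocycle_mem_span h).exists_finset
      exact ⟨S, fun _ => hS⟩
    · exact ⟨∅, fun h' => absurd h' h⟩
  have hB : ∀ b, ∃ S : Finset Face, (∀ v, overlapSign (vertexStar v) b = 1) →
      SymmDiffSpan faceBoundary S b := fun b => by
    by_cases h : ∀ v, overlapSign (vertexStar v) b = 1
    · obtain ⟨S, hS⟩ := (cycle_mem_span h).exists_finset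
      exact ⟨S, fun _ => hS⟩
    · exact ⟨∅, fun h' => absurd h' h⟩
  choose A hA using hA
  choose B hB using hB
  refine ⟨Λ ∪ (Λ.biUnion edgeNeighborhood ∪ Λ.powerset.biUnion fun a =>
    (A a).biUnion vertexStar ∪ (B a).biUnion faceBoundary), Finset.subset_union_left, ?_, ?_, ?_⟩
  · intro w hw
    obtain ⟨e, he, heΛ⟩ := Finset.not_disjoint_iff.1 hw
    refine (support_subset_edgeNeighborhood he).trans ?_
    exact (Finset.subset_biUnion_of_mem edgeNeighborhood heΛ).trans
      (Finset.subset_union_left.trans Finset.subset_union_right)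
  · refine fun a ha h => (hA a h).mono fun v hv e he => ?_
    simp only [Finset.mem_union, Finset.mem_biUnion]
    exact Or.inr (Or.inr ⟨a, Finset.mem_powerset.2 ha, Or.inl ⟨v, hv, he⟩⟩)
  · refine fun b hb h => (hB b h).mono fun p hp e he => ?_
    simp only [Finset.mem_union, Finset.mem_biUnion]
    exact Or.inr (Or.inr ⟨b, Finset.mem_powerset.2 hb, Or.inr ⟨p, hp, he⟩⟩)

theorem exists_compression (f : SignConfig) (Λ : Finset Edge) : ∃ Δ : Finset Edge, Λ ⊆ Δ ∧
    ∀ X ∈ localAlg Λ, ∃ z : ℂ,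
      groundProj f Δ * X * groundProj f Δ = z • groundProj f Δ := by
  obtain ⟨Δ, hΔ, hw, hA, hB⟩ := exists_enlargement Λ
  refine ⟨Δ, hΔ, fun X hX => ?_⟩
  have hspan := localAlg_le_span Λ hX
  clear hX
  induction hspan using Submodule.span_induction with
  | mem T hT =>
    obtain ⟨a, ha, b, hb, rfl⟩ := hT
    exact exists_pauli_compression f
      (fun v hv => hw (Sum.inl v) fun hd => hv (hd.mono_right hb))
      (fun p hp => hw (Sum.inr p) fun hd => hp (hd.mono_right ha)) (hA a ha) (hB b hb)
  | zero => exact ⟨0, by simp⟩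
  | add S T _ _ hS hT =>
    obtain ⟨s, hs⟩ := hS
    obtain ⟨t, ht⟩ := hT
    exact ⟨s + t, by rw [mul_add, add_mul, hs, ht, add_smul]⟩
  | smul c T _ hT =>
    obtain ⟨t, ht⟩ := hT
    exact ⟨c * t, by rw [mul_smul_comm, smul_mul_assoc, ht, smul_smul]⟩

theorem isLTQO_groundProj (f : SignConfig) : IsLTQO (groundProj f) := by
  intro X hX
  obtain ⟨Λ₀, hX⟩ := Set.mem_iUnion.1 hX
  obtain ⟨Δ, -, hΔ⟩ := exists_compression f Λ₀
  obtain ⟨z, hz⟩ := hΔ X hX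
  refine tendsto_const_nhds.congr' ?_
  filter_upwards [eventually_ge_atTop Δ] with Λ hΛ
  -- Frustration-freeness lets `P_Δ` be inserted on both sides of `X`, so the scalar found for `Δ`
  -- is inherited by every larger `Λ` and the norm is eventually zero.
  have h : groundProj f Λ * X * groundProj f Λ = z • groundProj f Λ := by
    calc groundProj f Λ * X * groundProj f Λ
        = groundProj f Λ * (groundProj f Δ * X * groundProj f Δ) * groundProj f Λ := by
          simp only [mul_assoc]
          rw [groundProj_mul_groundProj f hΛ]
          simp only [← mul_assoc]
          rw [groundProj_mul_groundProj' f hΛ]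
      _ = z • groundProj f Λ := by
          rw [hz, mul_smul_comm, smul_mul_assoc, groundProj_mul_groundProj' f hΛ,
            groundProj_mul_groundProj f (Finset.Subset.refl Λ)]
  rw [localState_eq f h, h, sub_self, norm_zero]

end ToricCode

theorem theorem3p6 (f : ToricCode.SignConfig) :
    ToricCode.IsFrustrationFreeNet (ToricCode.groundProj f) ∧
    ToricCode.IsLTQO (ToricCode.groundProj f) ∧
    ∀ Λ : Finset ToricCode.Edge, ∃ Δ : Finset ToricCode.Edge, Λ ⊆ Δ ∧
      ∀ X ∈ ToricCode.localAlg Λ,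
        ToricCode.groundProj f Δ * X * ToricCode.groundProj f Δ =
          ToricCode.localState (ToricCode.groundProj f) Δ X • ToricCode.groundProj f Δ := by
  refine ⟨ToricCode.isFrustrationFreeNet_groundProj f, ToricCode.isLTQO_groundProj f, fun Λ => ?_⟩
  obtain ⟨Δ, hΛΔ, hΔ⟩ := ToricCode.exists_compression f Λ
  refine ⟨Δ, hΛΔ, fun X hX => ?_⟩
  obtain ⟨z, hz⟩ := hΔ X hX
  rw [ToricCode.localState_eq f hz, hz]
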